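/- Let $q$ be a prime power, $\mathbb{F}_q$ the field with $q$ elements, and $\theta>0$. For integers $n\ge 0$ and $k$, let $\operatorname{Gr}(k,n)$ be the set of $k$-dimensional vector subspaces of $\mathbb{F}_q^n$ and $\operatorname{Gr}(n)=\bigcup_{k=0}^n\operatorname{Gr}(k,n)$. Fix injective linear maps $\mathbb{F}_q^0\hookrightarrow\mathbb{F}_q^1\hookrightarrow\mathbb{F}_q^2\hookrightarrow\cdots$ and identify $\mathbb{F}_q^n$ with its image in $\mathbb{F}_q^{n+1}$. For $w\in\operatorname{Gr}(n)$ let $$\operatorname{Dil}_{n+1}(w)=\{v\in\operatorname{Gr}(n+1): w\subset v,\ v\not\subset\mathbb{F}_q^n,\ \dim v-\dim w=1\}.$$ Let $X_1,X_2,\dots$ be independent random variables with $\Pr(X_i=1)=\frac{\theta q^{i-1}}{1+\theta q^{i-1}}$ and $\Pr(X_i=0)=\frac{1}{1+\theta q^{i-1}}$ (so that $Y_n=X_1+\cdots+X_n$ is a $q$-binomial process), and let $\{V_n\}_{n\ge 0}$ be an associated Grassmannian process: $V_n$ is a random element of $\operatorname{Gr}(n)$, $V_0=0$, $X_{n+1}$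 is independent of $V_n$, and, for all $w\in\operatorname{Gr}(n)$ and $v\in\operatorname{Gr}(n+1)$, $$\Pr(V_{n+1}=v\mid V_n=w,X_{n+1}=0)=[v=w],\qquad \Pr(V_{n+1}=v\mid V_n=w,X_{n+1}=1)=\frac{[v\in\operatorname{Dil}_{n+1}(w)]}{|\operatorname{Dil}_{n+1}(w)|}$$ whenever the conditioning event has positive probability. Write $(a;r)_\infty=\prod_{i\ge 0}(1-ar^i)$ and, for $d\in\mathbb{N}=\{0,1,2,\dots\}$, $$\mu(d)=\frac{q^{-\frac12\left(d-\left(\frac12-\log_q\theta\right)\right)^2+\frac12\left(\frac12-\log_q\theta\right)^2}\,(q^{-(d+1)};q^{-1})_\infty}{(q^{-1};q^{-1})_\infty\,(-\theta^{-1};q^{-1})_\infty}.$$ For $p\in[0,1)$ let $\Delta(p)$ be the smallest $d\in\mathbb{N}$ such that $\sum_{k=0}^d\mu(k)\ge p$. Let $H_2(x)=1-x^2-(1-x)^2$ be the binary quadratic entropy. **Theorem (asymptotic equipartition property for the Grassmannian process).** Let $\delta\in(0,1)$, and let $\epsilon\in(0,1)$ be such that $p_\epsilon:=1-\epsilon$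 is a continuity point of $\Delta:[0,1)\to\mathbb{N}$. For each $n$ let $A_n=\bigcup_{k=0}^{a_n}\operatorname{Gr}(n-k,n)$ be the smallest set of the form $\bigcup_{k=0}^{m}\operatorname{Gr}(n-k,n)$, $m\in\mathbb{N}$, such that $\Pr(V_n\notin A_n)\le\epsilon$. Then there exists $n_0\in\mathbb{N}$ such that, for every $n\ge n_0$, 1. $A_n=\bigcup_{k=0}^{\Delta(p_\epsilon)}\operatorname{Gr}(n-k,n)$; 2. for every $v\in A_n$, with $k=\dim v$, one has $\Pr(V_n=v)>0$ and $$\left|\frac{\log_q\big(\Pr(V_n=v)^{-1}\big)}{n}-\frac n2 H_2\!\left(\frac kn\right)\right|\le\delta.$$ Moreover, let $s(n,\epsilon)=\min\{|B| : B\subset\operatorname{Gr}(n),\ \Pr(V_n\in B)\ge 1-\epsilon\}$. Then $$\lim_{n\to\infty}\frac1n\log_q|A_n|=\lim_{n\to\infty}\frac1n\log_q s(n,\epsilon)=\lim_{n\to\infty}\frac n2H_2\!\left(\frac{\Delta(p_\epsilon)}{n}\right)=\Delta(p_\epsilon).$$ -/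

import Mathlib

open MeasureTheory ProbabilityTheory Filter Topology

noncomputable section

/-- The total Grassmannian `Gr(n)`: all vector subspaces of `F ^ n`. -/
abbrev TotalGr (F : Type*) [Field F] (n : ℕ) : Type _ := Submodule F (Fin n → F)

/-- `Gr(n)` is a finite set when `F` is finite; it carries the discrete σ-algebra. -/
instance TotalGr.instMeasurableSpace (F : Type*) [Field F] (n : ℕ) :
    MeasurableSpace (TotalGr F n) := ⊤

instance TotalGr.instDiscreteMeasurableSpace (F : Type*) [Field F] (n : ℕ) :
    DiscreteMeasurableSpace (TotalGr F n) := ⟨fun _ => trivial⟩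

/-- `Gr(k, n)`: the set of `k`-dimensional subspaces of `F ^ n` (empty if `k < 0` or `k > n`). -/
def Gr (F : Type*) [Field F] (k : ℤ) (n : ℕ) : Set (TotalGr F n) :=
  {W | (Module.finrank F W : ℤ) = k}

/-- The union of `Gr(n - k, n)` over `0 ≤ k ≤ m`. -/
def topGr (F : Type*) [Field F] (m n : ℕ) : Set (TotalGr F n) :=
  ⋃ k ∈ Finset.range (m + 1), Gr F ((n : ℤ) - (k : ℤ)) n

/-- The `(n+1)`-dilations of a subspace `w` of `F ^ n`, where `F ^ n` is regarded as a subspace of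
`F ^ (n+1)` through the embedding `e`: the subspaces `v` of `F ^ (n+1)` that contain `w`, are not
contained in `F ^ n`, and satisfy `dim v - dim w = 1`. -/
def dilations {F : Type*} [Field F] {n : ℕ} (e : (Fin n → F) →ₗ[F] (Fin (n + 1) → F))
    (w : TotalGr F n) : Set (TotalGr F (n + 1)) :=
  {v | w.map e ≤ v ∧ ¬ v ≤ LinearMap.range e ∧ Module.finrank F v = Module.finrank F w + 1}

/-- `X 0, X 1, …` (written `X₁, X₂, …` on paper, so `X i` is `X_{i+1}`) are independent Bernoulli
variables, `X_{i+1}` having parameter `θ q ^ i / (1 + θ q ^ i)`, and `Y n = X₁ + ⋯ + Xₙ` is the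
associated `q`-binomial process. -/
structure IsQBinomialProcess {Ω : Type*} [MeasurableSpace Ω] (P : Measure Ω) (q θ : ℝ)
    (X Y : ℕ → Ω → ℕ) : Prop where
  measurable : ∀ i, Measurable (X i)
  indep : iIndepFun X P
  prob_one : ∀ i, P.real (X i ⁻¹' {1}) = θ * q ^ i / (1 + θ * q ^ i)
  prob_zero : ∀ i, P.real (X i ⁻¹' {0}) = 1 / (1 + θ * q ^ i)
  sum_eq : ∀ n ω, Y n ω = ∑ i ∈ Finset.range n, X i ω

/-- `V` is a Grassmannian process driven by the Bernoulli variables `X` (with `X n` in the role of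
`X_{n+1}`), for the sequence of linear embeddings `e n : F ^ n → F ^ (n+1)`: the variable `X_{n+1}`
is independent of `V n`; given `V n = w` and `X_{n+1} = 0`, one has `V (n+1) = w`; given `V n = w`
and `X_{n+1} = 1`, the subspace `V (n+1)` is uniformly distributed on the dilations of `w`. -/
structure IsGrassmannianProcess {F : Type*} [Field F] {Ω : Type*} [MeasurableSpace Ω]
    (P : Measure Ω) (e : ∀ n : ℕ, (Fin n → F) →ₗ[F] (Fin (n + 1) → F))
    (X : ℕ → Ω → ℕ) (V : ∀ n : ℕ, Ω → TotalGr F n) : Prop where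
  measurable : ∀ n, Measurable (V n)
  zero : ∀ ω, V 0 ω = ⊥
  indep : ∀ n, IndepFun (V n) (X n) P
  step_zero : ∀ (n : ℕ) (w : TotalGr F n) (v : TotalGr F (n + 1)),
    P (V n ⁻¹' {w} ∩ X n ⁻¹' {0}) ≠ 0 →
      (cond P (V n ⁻¹' {w} ∩ X n ⁻¹' {0})).real (V (n + 1) ⁻¹' {v}) =
        Set.indicator {w.map (e n)} (fun _ => (1 : ℝ)) v
  step_one : ∀ (n : ℕ) (w : TotalGr F n) (v : TotalGr F (n + 1)),
    P (V n ⁻¹' {w} ∩ X n ⁻¹' {1}) ≠ 0 →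
      (cond P (V n ⁻¹' {w} ∩ X n ⁻¹' {1})).real (V (n + 1) ⁻¹' {v}) =
        Set.indicator (dilations (e n) w) (fun _ => 1 / ((dilations (e n) w).ncard : ℝ)) v

/-- The quadratic entropy (Tsallis 2-entropy) of a finite probability vector. -/
def quadEntropy {ι : Type*} [Fintype ι] (p : ι → ℝ) : ℝ := 1 - ∑ i, p i ^ 2

/-- The binary quadratic entropy `H₂(x) = H₂(x, 1 - x)`. -/
def binQuadEntropy (x : ℝ) : ℝ := quadEntropy ![x, 1 - x]

/-- The infinite Pochhammer symbol `(a; r)_∞`, the product of `1 - a r ^ i` over `i ≥ 0`. -/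
def qPochInf (a r : ℝ) : ℝ := ∏' i : ℕ, (1 - a * r ^ i)

/-- The function `μ(d)` (the limit law of the codimension `n - dim V n`). -/
def codimLaw (q θ : ℝ) (d : ℕ) : ℝ :=
  q ^ (-(1 / 2 : ℝ) * ((d : ℝ) - (1 / 2 - Real.logb q θ)) ^ 2
      + (1 / 2 : ℝ) * (1 / 2 - Real.logb q θ) ^ 2)
    * qPochInf (q ^ (-((d : ℝ) + 1))) q⁻¹
    / (qPochInf q⁻¹ q⁻¹ * qPochInf (-θ⁻¹) q⁻¹)

/-- `Δ(p)`, for `0 ≤ p < 1`: the smallest `d` with `μ(0) + ⋯ + μ(d) ≥ p`. -/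
def codimQuantile (q θ : ℝ) (p : ℝ) : ℕ :=
  sInf {d : ℕ | p ≤ ∑ k ∈ Finset.range (d + 1), codimLaw q θ k}

/-- The number `aₙ`: the least `m` such that the union of the `Gr(n - k, n)`, `k ≤ m`, has a
complement of probability at most `ε`. -/
def typicalIndex {F : Type*} [Field F] {Ω : Type*} [MeasurableSpace Ω] (P : Measure Ω)
    (V : ∀ n : ℕ, Ω → TotalGr F n) (ε : ℝ) (n : ℕ) : ℕ :=
  sInf {m : ℕ | P.real (V n ⁻¹' (topGr F m n)ᶜ) ≤ ε}

/-- The typical set `Aₙ`: the smallest set of the form `⋃_{k ≤ m} Gr(n - k, n)` whose complement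
has probability at most `ε`. -/
def typicalSet {F : Type*} [Field F] {Ω : Type*} [MeasurableSpace Ω] (P : Measure Ω)
    (V : ∀ n : ℕ, Ω → TotalGr F n) (ε : ℝ) (n : ℕ) : Set (TotalGr F n) :=
  topGr F (typicalIndex P V ε n) n

/-- `s(n, ε)`: the least cardinality of a set of subspaces of `F ^ n` that has probability at
least `1 - ε` under the law of `V n`. -/
def minCard {F : Type*} [Field F] {Ω : Type*} [MeasurableSpace Ω] (P : Measure Ω)
    (V : ∀ n : ℕ, Ω → TotalGr F n) (n : ℕ) (ε : ℝ) : ℕ :=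
  sInf {c : ℕ | ∃ B : Set (TotalGr F n), B.ncard = c ∧ 1 - ε ≤ P.real (V n ⁻¹' B)}

end

/-! Measured by codimension, the process has an explicit law. A subspace `v` of `F ^ (n+1)`
determines its predecessor, which is its trace `v.comap e` on the hyperplane `F ^ n`
(`mem_dilations_iff`). Conditioning on the last step therefore gives a one-term recursion. Since a
subspace of codimension d has exactly q^d dilations (`ncard_dilations`), the recursion solves to
P(V_n = v) = θ^(-d) q^(d(d+1)/2) q^(-nd) / Z_n, where d is the codimension of v and Z_n = ∏_{i<n} (1
+ θ⁻¹ q^(-i)) converges (`IsGrassmannianProcess.prob_mul_prod`). Multiplying by the Gaussian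
binomial gives the law of the codimension, which converges to μ with no loss of mass
(`hasSum_codimLaw`).

Put D = Δ(1-ε). Continuity of Δ at 1-ε says that the distribution function of μ crosses 1-ε strictly
at D. Strict crossing survives the limit, so a_n = D for large n. For fixed d, both -log_q P(V_n =
v)/n and (n/2) H₂(1 - d/n) = d - d²/n tend to d, and only the finitely many d ≤ D matter.

For the cardinalities, |A_n| ≤ (D+1) q^(nD). Conversely, let B have probability at least 1-ε.
Codimensions below D carry too little mass, and by tightness very large ones are negligible. So B
keeps a fixed amount of mass on subspaces of probability O(q^(-nD)), whence |B| ≥ c q^(nD)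
(`IsGrassmannianProcess.exists_le_minCard`). Since A_n is itself such a B, both counts are squeezed.
-/

/-- The set of subspaces of `F ^ n` of codimension `d`. -/
def codimGr (F : Type*) [Field F] (d n : ℕ) : Set (TotalGr F n) :=
  {W | Module.finrank F W + d = n}

lemma Gr_sub_eq_codimGr (F : Type*) [Field F] (d n : ℕ) :
    Gr F ((n : ℤ) - (d : ℤ)) n = codimGr F d n := by
  ext W
  simp only [Gr, codimGr, Set.mem_ofPred_eq]
  omega

lemma topGr_eq_biUnion_codimGr (F : Type*) [Field F] (m n : ℕ) :
    topGr F m n = ⋃ d ∈ Finset.range (m + 1), codimGr F d n := by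
  simp only [topGr, Gr_sub_eq_codimGr]

lemma mem_topGr_iff {F : Type*} [Field F] {m n : ℕ} {v : TotalGr F n} :
    v ∈ topGr F m n ↔ ∃ d ≤ m, Module.finrank F v + d = n := by
  simp [topGr_eq_biUnion_codimGr, codimGr]

lemma pairwise_disjoint_codimGr (F : Type*) [Field F] (n : ℕ) :
    Pairwise (Function.onFun Disjoint fun d => codimGr F d n) := by
  intro d d' hd
  rw [Function.onFun, Set.disjoint_left]
  intro W h h'
  simp only [codimGr, Set.mem_ofPred_eq] at h h'
  omega

/-! ### Subspaces of `F ^ (n+1)` relative to a hyperplane. -/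

section Geometry

variable {F : Type*} [Field F] {n : ℕ} {e : (Fin n → F) →ₗ[F] (Fin (n + 1) → F)}

lemma finrank_map_of_injective (he : Function.Injective e) (w : TotalGr F n) :
    Module.finrank F (w.map e) = Module.finrank F w :=
  (LinearEquiv.finrank_eq (w.equivMapOfInjective e he)).symm

/-- The range of `e` is a hyperplane, so a subspace not inside it spans the whole space together
with it. The dimension formula then shows that the trace loses exactly one dimension. -/
lemma finrank_comap_add_one (he : Function.Injective e) {v : TotalGr F (n + 1)}
    (hv : ¬ v ≤ LinearMap.range e) :
    Module.finrank F (v.comap e) + 1 = Module.finrank F v := by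
  have h1 : Module.finrank F (v.comap e) = Module.finrank F (LinearMap.range e ⊓ v : Submodule F _) := by
    rw [← finrank_map_of_injective he, Submodule.map_comap_eq]
  have h2 := Submodule.finrank_sup_add_finrank_inf_eq (LinearMap.range e) v
  have h3 : Module.finrank F (LinearMap.range e) = n := by
    rw [LinearMap.finrank_range_of_inj he]; simp
  have h4 : LinearMap.range e < LinearMap.range e ⊔ v := by
    refine lt_of_le_of_ne le_sup_left fun h => hv ?_
    rw [h]; exact le_sup_right
  have h5 := Submodule.finrank_lt_finrank_of_lt h4
  have h6 := Submodule.finrank_le (LinearMap.range e ⊔ v)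
  simp only [Module.finrank_fintype_fun_eq_card, Fintype.card_fin] at h6
  omega

/-- The dilation sets of distinct `w` are thus disjoint, being fibres of `Submodule.comap e`. This
is what makes the process reversible step by step. -/
lemma mem_dilations_iff (he : Function.Injective e) {w : TotalGr F n} {v : TotalGr F (n + 1)} :
    v ∈ dilations e w ↔ ¬ v ≤ LinearMap.range e ∧ v.comap e = w := by
  constructor
  · rintro ⟨h1, h2, h3⟩
    refine ⟨h2, ?_⟩
    have h4 := finrank_comap_add_one he h2
    exact (Submodule.eq_of_le_of_finrank_eq (Submodule.map_le_iff_le_comap.1 h1) (by omega)).symm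
  · rintro ⟨h1, rfl⟩
    exact ⟨Submodule.map_comap_le _ _, h1, (finrank_comap_add_one he h1).symm⟩

lemma sup_span_singleton_mem_dilations (he : Function.Injective e) (w : TotalGr F n)
    {x : Fin (n + 1) → F} (hx : x ∉ LinearMap.range e) :
    w.map e ⊔ Submodule.span F {x} ∈ dilations e w := by
  refine ⟨le_sup_left, fun h => hx (h ?_), ?_⟩
  · exact Submodule.mem_sup_right (Submodule.mem_span_singleton_self x)
  · have hx' : x ∉ w.map e := fun h => hx (LinearMap.map_le_range h)
    have h := Submodule.finrank_sup_add_finrank_inf_eq (w.map e) (Submodule.span F {x})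
    have h0 : x ≠ 0 := fun h => hx (h ▸ zero_mem _)
    have h1 : w.map e ⊓ Submodule.span F {x} = ⊥ := by
      rw [← disjoint_iff, Submodule.disjoint_span_singleton' h0]
      exact hx'
    rw [h1, finrank_bot, finrank_span_singleton h0, finrank_map_of_injective he] at h
    simpa using h

lemma sup_span_singleton_eq_of_mem (he : Function.Injective e) {w : TotalGr F n}
    {v : TotalGr F (n + 1)} (hv : v ∈ dilations e w) {x : Fin (n + 1) → F}
    (hx : x ∉ LinearMap.range e) : w.map e ⊔ Submodule.span F {x} = v ↔ x ∈ v := by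
  constructor
  · rintro rfl
    exact Submodule.mem_sup_right (Submodule.mem_span_singleton_self x)
  · intro h
    refine Submodule.eq_of_le_of_finrank_eq (sup_le hv.1 ?_) ?_
    · simpa using h
    · rw [(sup_span_singleton_mem_dilations he w hx).2.2, hv.2.2]

lemma card_submodule_eq_pow [Fintype F] {V : Type*} [AddCommGroup V] [Module F V] [Finite V]
    (W : Submodule F V) :
    (W : Set V).ncard = Fintype.card F ^ Module.finrank F W := by
  rw [← Nat.card_coe_set_eq, ← Nat.card_eq_fintype_card]
  exact Module.natCard_eq_pow_finrank

/-- Double counting: each of the q^(n+1) - q^n vectors x off the hyperplane generates a dilation w +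
⟨x⟩, and a dilation v arises from exactly the q^(k+1) - q^k vectors of v \ w, where k = dim w. -/
lemma ncard_dilations [Fintype F] (he : Function.Injective e) {w : TotalGr F n} {d : ℕ}
    (hw : Module.finrank F w + d = n) : (dilations e w).ncard = Fintype.card F ^ d := by
  classical
  set q := Fintype.card F with hq
  have hq1 : 1 < q := Fintype.one_lt_card
  have hfin : (dilations e w).Finite := Set.toFinite _
  have hcount := Finset.card_eq_sum_card_fiberwise
    (s := (Set.toFinite ((LinearMap.range e : Set (Fin (n + 1) → F))ᶜ)).toFinset)
    (t := hfin.toFinset) (f := fun x => w.map e ⊔ Submodule.span F {x})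
    (fun x hx => by
      simp only [Set.Finite.coe_toFinset] at hx ⊢
      exact sup_span_singleton_mem_dilations he w hx)
  have hfib : ∀ v ∈ hfin.toFinset,
      ((Set.toFinite ((LinearMap.range e : Set (Fin (n + 1) → F))ᶜ)).toFinset.filter
        fun x => w.map e ⊔ Submodule.span F {x} = v).card
        = q ^ (Module.finrank F w + 1) - q ^ Module.finrank F w := by
    intro v hv
    rw [Set.Finite.mem_toFinset] at hv
    have hv' := (mem_dilations_iff he).1 hv
    have h1 : ((((Set.toFinite ((LinearMap.range e : Set (Fin (n + 1) → F))ᶜ)).toFinset.filter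
        fun x => w.map e ⊔ Submodule.span F {x} = v) : Finset _) : Set (Fin (n + 1) → F))
        = (v : Set (Fin (n + 1) → F)) \ (w.map e : Submodule F _) := by
      ext x
      simp only [Finset.coe_filter, Set.Finite.mem_toFinset, Set.mem_compl_iff, SetLike.mem_coe,
        Set.mem_ofPred_eq, Set.mem_sdiff]
      constructor
      · rintro ⟨hx, h⟩
        exact ⟨(sup_span_singleton_eq_of_mem he hv hx).1 h, fun h' => hx (LinearMap.map_le_range h')⟩
      · rintro ⟨hx, h⟩
        have hxr : x ∉ LinearMap.range e := by
          intro hr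
          rw [← hv'.2, Submodule.map_comap_eq] at h
          exact h ⟨hr, hx⟩
        exact ⟨hxr, (sup_span_singleton_eq_of_mem he hv hxr).2 hx⟩
    rw [← Set.ncard_coe_finset, h1, Set.ncard_sdiff hv.1, card_submodule_eq_pow,
      card_submodule_eq_pow, hv.2.2, finrank_map_of_injective he]
  rw [Finset.sum_congr rfl hfib, Finset.sum_const, smul_eq_mul, ← Set.ncard_eq_toFinset_card,
    ← Set.ncard_eq_toFinset_card, Set.ncard_compl, card_submodule_eq_pow,
    LinearMap.finrank_range_of_inj he] at hcount
  simp only [Nat.card_eq_fintype_card, Fintype.card_pi, Finset.prod_const, Finset.card_univ,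
    Fintype.card_fin, Module.finrank_fintype_fun_eq_card, ← hq] at hcount
  have h2 : ∀ k, q ^ (k + 1) - q ^ k = q ^ k * (q - 1) := by
    intro k; rw [pow_succ, Nat.mul_sub, mul_one]
  rw [h2, h2] at hcount
  have hpos : 0 < q ^ Module.finrank F w * (q - 1) := by
    have : 0 < q - 1 := by omega
    positivity
  refine Nat.eq_of_mul_eq_mul_right hpos ?_
  rw [← hcount]
  conv_lhs => rw [← hw]
  ring

lemma setOf_le_range_inter_codimGr (he : Function.Injective e) (d : ℕ) :
    {v : TotalGr F (n + 1) | v ≤ LinearMap.range e} ∩ codimGr F d (n + 1) =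
      Submodule.map e '' {w | Module.finrank F w + d = n + 1} := by
  ext v
  constructor
  · rintro ⟨h1, h2⟩
    have h3 : (v.comap e).map e = v := Submodule.map_comap_eq_of_le h1
    refine ⟨v.comap e, ?_, h3⟩
    rw [Set.mem_ofPred_eq, ← finrank_map_of_injective he, h3]
    exact h2
  · rintro ⟨w, hw, rfl⟩
    refine ⟨LinearMap.map_le_range, ?_⟩
    rw [codimGr, Set.mem_ofPred_eq, finrank_map_of_injective he]
    exact hw

lemma ncard_codimGr_sdiff_le_range [Fintype F] (he : Function.Injective e) (d : ℕ) :
    (codimGr F d (n + 1) \ {v | v ≤ LinearMap.range e}).ncard =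
      Fintype.card F ^ d * (codimGr F d n).ncard := by
  classical
  have hs := Set.toFinite (codimGr F d (n + 1) \ {v | v ≤ LinearMap.range e})
  have ht := Set.toFinite (codimGr F d n)
  rw [Set.ncard_eq_toFinset_card _ hs, Set.ncard_eq_toFinset_card _ ht]
  rw [Finset.card_eq_sum_card_fiberwise (f := Submodule.comap e) (t := ht.toFinset)]
  · rw [Finset.sum_congr rfl (g := fun _ => Fintype.card F ^ d), Finset.sum_const, smul_eq_mul,
      mul_comm]
    intro w hw
    rw [Set.Finite.mem_toFinset] at hw
    rw [← ncard_dilations he hw, ← Set.ncard_coe_finset]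
    congr 1
    ext v
    rw [mem_dilations_iff he]
    simp only [Finset.coe_filter, Set.Finite.mem_toFinset, Set.mem_sdiff, Set.mem_ofPred_eq]
    constructor
    · rintro ⟨⟨-, h⟩, h'⟩
      exact ⟨h, h'⟩
    · rintro ⟨h, h'⟩
      refine ⟨⟨?_, h⟩, h'⟩
      have h3 := finrank_comap_add_one he h
      rw [h'] at h3
      simp only [codimGr, Set.mem_ofPred_eq] at hw ⊢
      omega
  · intro v hv
    simp only [Set.Finite.coe_toFinset] at hv ⊢
    have h3 := finrank_comap_add_one he hv.2
    have h4 := hv.1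
    simp only [codimGr, Set.mem_ofPred_eq] at h4 ⊢
    omega

/-- The q-Pascal rule, splitting subspaces by whether they lie in the hyperplane. The first count is
codimension d - 1 in `F ^ n`, phrased so as to make sense (and vanish) at d = 0. -/
lemma ncard_codimGr_succ_eq_add [Fintype F] (he : Function.Injective e) (d : ℕ) :
    (codimGr F d (n + 1)).ncard = {w : TotalGr F n | Module.finrank F w + d = n + 1}.ncard +
      Fintype.card F ^ d * (codimGr F d n).ncard := by
  rw [← ncard_codimGr_sdiff_le_range he,
    ← Set.ncard_inter_add_ncard_sdiff_eq_ncard (codimGr F d (n + 1)) {v | v ≤ LinearMap.range e},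
    Set.inter_comm, setOf_le_range_inter_codimGr he,
    Set.ncard_image_of_injective _ (Submodule.map_injective_of_injective he)]

end Geometry

/-! ### Gaussian binomials and one-step normalisation. -/

lemma ncard_codimGr_zero_right (F : Type*) [Field F] (d : ℕ) :
    (codimGr F d 0).ncard = if d = 0 then 1 else 0 := by
  have h : ∀ w : TotalGr F 0, Module.finrank F w = 0 := fun w =>
    Module.finrank_zero_of_subsingleton
  rcases Nat.eq_zero_or_pos d with rfl | hd
  · simp [codimGr, h]
  · simp [codimGr, h, hd.ne']

/-- The Gaussian binomial formula for the number of subspaces of codimension `d`. -/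
lemma ncard_codimGr_mul_prod {F : Type*} [Field F] [Fintype F]
    (e : ∀ n : ℕ, (Fin n → F) →ₗ[F] (Fin (n + 1) → F))
    (he : ∀ n, Function.Injective (e n)) (n d : ℕ) :
    ((codimGr F d n).ncard : ℝ) * ∏ i ∈ Finset.range d, ((Fintype.card F : ℝ) ^ (i + 1) - 1) =
      ∏ i ∈ Finset.range d, ((Fintype.card F : ℝ) ^ (n - i) - 1) := by
  set q : ℝ := (Fintype.card F : ℝ) with hq
  induction n generalizing d with
  | zero =>
    rw [ncard_codimGr_zero_right]
    rcases Nat.eq_zero_or_pos d with rfl | hd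
    · simp
    · simp [hd.ne']
  | succ n ih =>
    rw [ncard_codimGr_succ_eq_add (he n)]
    cases d with
    | zero =>
      have h0 : {w : TotalGr F n | Module.finrank F w + 0 = n + 1} = ∅ := by
        ext w
        have := Submodule.finrank_le w
        simp only [Module.finrank_fintype_fun_eq_card, Fintype.card_fin] at this
        simp only [Set.mem_ofPred_eq, Set.mem_empty_iff_false, iff_false]
        omega
      have := ih 0
      rw [h0]
      simpa using this
    | succ d =>
      have h0 : {w : TotalGr F n | Module.finrank F w + (d + 1) = n + 1} = codimGr F d n := by
        ext w
        simp only [Set.mem_ofPred_eq, codimGr]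
        omega
      have h1 := ih (d + 1)
      have h2 := ih d
      have h3 : ∏ i ∈ Finset.range (d + 1), (q ^ (n + 1 - i) - 1)
          = (∏ i ∈ Finset.range d, (q ^ (n - i) - 1)) * (q ^ (n + 1) - 1) := by
        rw [Finset.prod_range_succ']
        simp
      rw [h0, h3]
      push_cast
      rw [← hq, add_mul, mul_assoc, h1, Finset.prod_range_succ, ← mul_assoc, h2,
        Finset.prod_range_succ]
      -- When d > n, the truncated exponent makes the factor at i = n equal to q^0 - 1 = 0, so both
      -- sides vanish.
      rcases le_or_gt d n with hd | hd
      · have : q ^ (n + 1) = q ^ (d + 1) * q ^ (n - d) := by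
          rw [← pow_add]; congr 1; omega
        rw [this]; ring
      · rw [Finset.prod_eq_zero (Finset.mem_range.2 hd) (by simp)]
        ring

/-- Together with `mul_div_mul_one_add_eq`, this writes the two step probabilities over the common
factor 1 + θ⁻¹q^(-n), whose product over n converges. -/
lemma one_div_mul_one_add_eq {θ q : ℝ} (hθ : 0 < θ) (hq : 0 < q) (n : ℕ) :
    1 / (1 + θ * q ^ n) * (1 + θ⁻¹ * q⁻¹ ^ n) = θ⁻¹ * q⁻¹ ^ n := by
  rw [inv_pow]
  field_simp
  ring

lemma mul_div_mul_one_add_eq {θ q : ℝ} (hθ : 0 < θ) (hq : 0 < q) (n : ℕ) :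
    θ * q ^ n / (1 + θ * q ^ n) * (1 + θ⁻¹ * q⁻¹ ^ n) = 1 := by
  rw [inv_pow]
  field_simp
  ring

lemma inv_pow_succ_pow_mul_pow {q : ℝ} (hq : q ≠ 0) (n k : ℕ) :
    (q⁻¹ ^ (n + 1)) ^ k * q ^ k = (q⁻¹ ^ n) ^ k := by
  rw [← mul_pow, pow_succ, inv_mul_cancel_right₀ hq]

/-! ### Transition recursion and the law of a single subspace. -/

section Law

variable {F : Type*} [Field F] [Fintype F]
  {e : ∀ n : ℕ, (Fin n → F) →ₗ[F] (Fin (n + 1) → F)}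
  {Ω : Type*} [MeasurableSpace Ω] {P : Measure Ω}
  {n : ℕ} {q θ : ℝ} {X Y : ℕ → Ω → ℕ} {V : ∀ n : ℕ, Ω → TotalGr F n}

lemma IsGrassmannianProcess.prob_inter (hV : IsGrassmannianProcess P e X V) (n : ℕ) (w : TotalGr F n) (x : ℕ) :
    P.real (V n ⁻¹' {w} ∩ X n ⁻¹' {x}) = P.real (V n ⁻¹' {w}) * P.real (X n ⁻¹' {x}) := by
  have := (hV.indep n).measure_inter_preimage_eq_mul {w} {x} (measurableSet_singleton w)
    (measurableSet_singleton x)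
  simp [measureReal_def, this]

variable [IsProbabilityMeasure P]

lemma IsQBinomialProcess.ae_mem_zero_one (hY : IsQBinomialProcess P q θ X Y) (hθ : 0 < θ)
    (hq : 0 < q) (n : ℕ) : ∀ᵐ ω ∂P, X n ω = 0 ∨ X n ω = 1 := by
  have h0 := hY.measurable n (measurableSet_singleton 0)
  have h1 := hY.measurable n (measurableSet_singleton 1)
  have hd : Disjoint (X n ⁻¹' {0}) (X n ⁻¹' {1}) :=
    Disjoint.preimage _ (by simp)
  have hpos : 0 < 1 + θ * q ^ n := by positivity
  have h : P.real (X n ⁻¹' {0} ∪ X n ⁻¹' {1}) = 1 := by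
    rw [measureReal_union hd h1, hY.prob_zero, hY.prob_one]
    field_simp
  have hc : P (X n ⁻¹' {0} ∪ X n ⁻¹' {1})ᶜ = 0 := by
    rw [← measureReal_eq_zero_iff, probReal_compl_eq_one_sub (h0.union h1), h, sub_self]
  rw [ae_iff]
  convert hc using 2
  ext ω
  simp

lemma measureReal_inter_eq_mul_cond {A B : Set Ω} (hA : MeasurableSet A) {c : ℝ}
    (h : P A ≠ 0 → (cond P A).real B = c) : P.real (A ∩ B) = P.real A * c := by
  by_cases hA0 : P A = 0
  · have h1 : P.real A = 0 := by simp [measureReal_def, hA0]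
    have h2 : P.real (A ∩ B) = 0 := by
      simp [measureReal_def, measure_mono_null Set.inter_subset_left hA0]
    rw [h1, h2, zero_mul]
  · rw [← h hA0, measureReal_def, measureReal_def, measureReal_def, cond_apply hA,
      ← ENNReal.toReal_mul, ENNReal.mul_inv_cancel_left hA0 (measure_ne_top P A)]

lemma IsGrassmannianProcess.prob_succ (hV : IsGrassmannianProcess P e X V)
    (hY : IsQBinomialProcess P q θ X Y) (hθ : 0 < θ) (hq : 0 < q) [Fintype (TotalGr F n)]
    (v : TotalGr F (n + 1)) :
    P.real (V (n + 1) ⁻¹' {v}) = ∑ w : TotalGr F n, P.real (V n ⁻¹' {w}) *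
      (1 / (1 + θ * q ^ n) * Set.indicator {w.map (e n)} (fun _ => (1 : ℝ)) v +
        θ * q ^ n / (1 + θ * q ^ n) *
          Set.indicator (dilations (e n) w) (fun _ => 1 / ((dilations (e n) w).ncard : ℝ)) v) := by
  have hmV := fun (w : TotalGr F n) => hV.measurable n (measurableSet_singleton w)
  have hmX := fun x => hY.measurable n (measurableSet_singleton x)
  have hmv := hV.measurable (n + 1) (measurableSet_singleton v)
  -- Only an almost sure equality: the variable `X n` takes values in {0, 1} merely up to a null
  -- set.
  have hsplit : V (n + 1) ⁻¹' {v} =ᵐ[P] ⋃ w ∈ (Finset.univ : Finset (TotalGr F n)),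
      ((V n ⁻¹' {w} ∩ X n ⁻¹' {0}) ∩ V (n + 1) ⁻¹' {v} ∪
        (V n ⁻¹' {w} ∩ X n ⁻¹' {1}) ∩ V (n + 1) ⁻¹' {v}) := by
    rw [eventuallyEq_set]
    filter_upwards [hY.ae_mem_zero_one hθ hq n] with ω hω
    simp only [Set.mem_iUnion, Set.mem_union, Set.mem_inter_iff, Set.mem_preimage,
      Set.mem_singleton_iff, Finset.mem_univ, exists_prop, true_and]
    constructor
    · intro h
      exact ⟨V n ω, hω.imp (fun h' => ⟨⟨rfl, h'⟩, h⟩) (fun h' => ⟨⟨rfl, h'⟩, h⟩)⟩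
    · rintro ⟨w, h | h⟩ <;> exact h.2
  rw [measureReal_congr hsplit, measureReal_biUnion_finset]
  · refine Finset.sum_congr rfl fun w _ => ?_
    rw [measureReal_union, measureReal_inter_eq_mul_cond ((hmV w).inter (hmX 0)) (hV.step_zero n w v),
      measureReal_inter_eq_mul_cond ((hmV w).inter (hmX 1)) (hV.step_one n w v),
      hV.prob_inter, hV.prob_inter, hY.prob_zero, hY.prob_one]
    · ring
    · rw [Set.disjoint_left]
      rintro ω ⟨⟨-, h⟩, -⟩ ⟨⟨-, h'⟩, -⟩
      simp only [Set.mem_preimage, Set.mem_singleton_iff] at h h'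
      omega
    · exact ((hmV w).inter (hmX 1)).inter hmv
  · intro w _ w' _ hww
    rw [Function.onFun, Set.disjoint_left]
    rintro ω (h | h) (h' | h') <;> exact hww (h.1.1.symm.trans h'.1.1)
  · intro w _
    exact (((hmV w).inter (hmX 0)).inter hmv).union (((hmV w).inter (hmX 1)).inter hmv)

/-- Whether the last step is a stay or a dilation, the predecessor of `v` can only be `v.comap (e
n)`, so the total probability sum has one surviving term. -/
lemma IsGrassmannianProcess.prob_succ_eq_comap (hV : IsGrassmannianProcess P e X V)
    (hY : IsQBinomialProcess P q θ X Y) (hθ : 0 < θ) (hq : 0 < q)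
    (he : ∀ n, Function.Injective (e n)) (v : TotalGr F (n + 1)) :
    P.real (V (n + 1) ⁻¹' {v}) = P.real (V n ⁻¹' {v.comap (e n)}) *
      (1 / (1 + θ * q ^ n) * Set.indicator {(v.comap (e n)).map (e n)} (fun _ => (1 : ℝ)) v +
        θ * q ^ n / (1 + θ * q ^ n) *
          Set.indicator (dilations (e n) (v.comap (e n)))
            (fun _ => 1 / ((dilations (e n) (v.comap (e n))).ncard : ℝ)) v) := by
  have : Fintype (TotalGr F n) := Fintype.ofFinite _
  rw [hV.prob_succ hY hθ hq, Finset.sum_eq_single (v.comap (e n))]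
  · intro w _ hw
    rw [Set.indicator_of_notMem, Set.indicator_of_notMem]
    · simp
    · exact fun h => hw ((mem_dilations_iff (he n)).1 h).2.symm
    · rintro rfl
      exact hw (Submodule.comap_map_eq_of_injective (he n) w).symm
  · simp

/-- The law of the Grassmannian process, in terms of the codimension. -/
lemma IsGrassmannianProcess.prob_mul_prod (hV : IsGrassmannianProcess P e X V)
    (hY : IsQBinomialProcess P (Fintype.card F) θ X Y) (hθ : 0 < θ)
    (he : ∀ n, Function.Injective (e n)) (n : ℕ) :
    ∀ (d : ℕ) (v : TotalGr F n), v ∈ codimGr F d n →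
    P.real (V n ⁻¹' {v}) * ∏ i ∈ Finset.range n, (1 + θ⁻¹ * (Fintype.card F : ℝ)⁻¹ ^ i) =
      θ⁻¹ ^ d * ((Fintype.card F : ℝ)⁻¹ ^ n) ^ d *
        ∏ i ∈ Finset.range d, (Fintype.card F : ℝ) ^ (i + 1) := by
  have hq : 0 < (Fintype.card F : ℝ) := by exact_mod_cast Fintype.card_pos
  induction n with
  | zero =>
    intro d v hv
    have hd : d = 0 := by simp only [codimGr, Set.mem_ofPred_eq] at hv; omega
    subst hd
    have : V 0 ⁻¹' {v} = Set.univ := by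
      ext ω
      simpa using Subsingleton.elim _ _
    simp [this]
  | succ n ih =>
    intro d v hv
    have hstep := hV.prob_succ_eq_comap hY hθ hq he v
    have hpos : 0 < 1 + θ * (Fintype.card F : ℝ) ^ n := by positivity
    have hcodim : Module.finrank F v + d = n + 1 := hv
    rw [hstep, Finset.prod_range_succ]
    by_cases hr : v ≤ LinearMap.range (e n)
    · have hmc : (v.comap (e n)).map (e n) = v := Submodule.map_comap_eq_of_le hr
      have hrank : Module.finrank F (v.comap (e n)) = Module.finrank F v := by
        rw [← finrank_map_of_injective (he n), hmc]
      have hle := Submodule.finrank_le (v.comap (e n))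
      simp only [Module.finrank_fintype_fun_eq_card, Fintype.card_fin] at hle
      -- Inside the hyperplane the codimension is positive, and it was one less at time n.
      obtain ⟨d, rfl⟩ : ∃ d', d = d' + 1 := ⟨d - 1, by omega⟩
      have h := ih d (v.comap (e n)) (by simp only [codimGr, Set.mem_ofPred_eq]; omega)
      rw [hmc, Set.indicator_of_mem (Set.mem_singleton v),
        Set.indicator_of_notMem (fun h => h.2.1 hr), Finset.prod_range_succ _ d]
      calc _ = (P.real (V n ⁻¹' {v.comap (e n)}) *
            ∏ i ∈ Finset.range n, (1 + θ⁻¹ * (Fintype.card F : ℝ)⁻¹ ^ i)) *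
            (1 / (1 + θ * (Fintype.card F : ℝ) ^ n) * (1 + θ⁻¹ * (Fintype.card F : ℝ)⁻¹ ^ n)) := by
              ring
        _ = _ := by
              rw [h, one_div_mul_one_add_eq hθ hq n]
              linear_combination (-θ⁻¹ ^ (d + 1) *
                ∏ i ∈ Finset.range d, (Fintype.card F : ℝ) ^ (i + 1)) *
                inv_pow_succ_pow_mul_pow hq.ne' n (d + 1)
    · have hmem : v ∈ dilations (e n) (v.comap (e n)) := (mem_dilations_iff (he n)).2 ⟨hr, rfl⟩
      have hrank := finrank_comap_add_one (he n) hr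
      have hw : Module.finrank F (v.comap (e n)) + d = n := by omega
      have hne : v ∉ ({(v.comap (e n)).map (e n)} : Set _) := by
        intro h
        rw [Set.mem_singleton_iff] at h
        exact hr (h ▸ LinearMap.map_le_range)
      have h := ih d (v.comap (e n)) hw
      rw [Set.indicator_of_notMem hne, Set.indicator_of_mem hmem, ncard_dilations (he n) hw]
      calc _ = (P.real (V n ⁻¹' {v.comap (e n)}) *
            ∏ i ∈ Finset.range n, (1 + θ⁻¹ * (Fintype.card F : ℝ)⁻¹ ^ i)) *
            (θ * (Fintype.card F : ℝ) ^ n / (1 + θ * (Fintype.card F : ℝ) ^ n) *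
              (1 / ((Fintype.card F ^ d : ℕ) : ℝ)) *
              (1 + θ⁻¹ * (Fintype.card F : ℝ)⁻¹ ^ n)) := by
              ring
        _ = _ := by
              rw [h, mul_right_comm (θ * _ / _), mul_div_mul_one_add_eq hθ hq n, one_mul,
                mul_one_div, div_eq_iff (by positivity)]
              push_cast
              linear_combination (-θ⁻¹ ^ d *
                ∏ i ∈ Finset.range d, (Fintype.card F : ℝ) ^ (i + 1)) *
                inv_pow_succ_pow_mul_pow hq.ne' n d

end Law

/-! ### Infinite products, the limit law and its quantiles. -/

section Analysis

variable {q θ : ℝ}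

lemma summable_mul_inv_pow (hq : 1 < q) (a : ℝ) : Summable fun i : ℕ => -(a * q⁻¹ ^ i) :=
  ((summable_geometric_of_lt_one (by positivity) (inv_lt_one_of_one_lt₀ hq)).mul_left a).neg

lemma multipliable_one_sub_mul_inv_pow (hq : 1 < q) (a : ℝ) :
    Multipliable fun i : ℕ => 1 - a * q⁻¹ ^ i := by
  simpa [sub_eq_add_neg] using
    multipliable_one_add_of_summable (summable_mul_inv_pow hq a).norm

lemma tendsto_prod_qPochInf (hq : 1 < q) (a : ℝ) :
    Tendsto (fun n => ∏ i ∈ Finset.range n, (1 - a * q⁻¹ ^ i)) atTop (𝓝 (qPochInf a q⁻¹)) :=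
  (multipliable_one_sub_mul_inv_pow hq a).hasProd.tendsto_prod_nat

lemma qPochInf_ne_zero (hq : 1 < q) {a : ℝ} (ha : ∀ i : ℕ, 1 - a * q⁻¹ ^ i ≠ 0) :
    qPochInf a q⁻¹ ≠ 0 := by
  have := tprod_one_add_ne_zero_of_summable (f := fun i : ℕ => -(a * q⁻¹ ^ i))
    (by simpa [← sub_eq_add_neg] using ha) (summable_mul_inv_pow hq a).norm
  simpa [qPochInf, sub_eq_add_neg] using this

lemma prod_mul_qPochInf (hq : 1 < q) (a : ℝ) (d : ℕ) :
    (∏ i ∈ Finset.range d, (1 - a * q⁻¹ ^ i)) * qPochInf (a * q⁻¹ ^ d) q⁻¹ = qPochInf a q⁻¹ := by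
  have h := Multipliable.prod_mul_tprod_nat_mul' (f := fun i : ℕ => 1 - a * q⁻¹ ^ i) (k := d)
    ((multipliable_one_sub_mul_inv_pow hq (a * q⁻¹ ^ d)).congr fun i => by ring)
  rw [qPochInf, qPochInf, ← h]
  congr 2
  funext i
  ring

/-- The normalising factor `∏ (1 + θ⁻¹ q ^ (-i))`, over `i < n`, of the law of the process. -/
noncomputable def normalizer (q θ : ℝ) (n : ℕ) : ℝ := ∏ i ∈ Finset.range n, (1 + θ⁻¹ * q⁻¹ ^ i)

/-- The unnormalised limit law of the codimension. -/
noncomputable def codimWeight (q θ : ℝ) (d : ℕ) : ℝ :=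
  θ⁻¹ ^ d * ∏ i ∈ Finset.range d, (q / (q ^ (i + 1) - 1))

/-- The law of the codimension of the process at time `n`. -/
noncomputable def codimProb (q θ : ℝ) (d n : ℕ) : ℝ :=
  (codimWeight q θ d * ∏ i ∈ Finset.range d, ((q ^ (n - i) - 1) * q⁻¹ ^ n * q ^ i)) / normalizer q θ n

lemma one_le_normalizer (hq : 1 < q) (hθ : 0 < θ) (n : ℕ) : 1 ≤ normalizer q θ n := by
  have hq0 : 0 < q := by linarith
  exact Finset.one_le_prod (fun i _ => by have : 0 ≤ θ⁻¹ * q⁻¹ ^ i := by positivity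
                                          linarith)

lemma tendsto_normalizer (hq : 1 < q) (θ : ℝ) :
    Tendsto (normalizer q θ) atTop (𝓝 (qPochInf (-θ⁻¹) q⁻¹)) := by
  refine (tendsto_prod_qPochInf hq (-θ⁻¹)).congr fun n => ?_
  simp [normalizer]

lemma one_le_qPochInf (hq : 1 < q) (hθ : 0 < θ) : 1 ≤ qPochInf (-θ⁻¹) q⁻¹ :=
  ge_of_tendsto' (tendsto_normalizer hq θ) (one_le_normalizer hq hθ)

lemma pow_succ_sub_one_pos (hq : 1 < q) (i : ℕ) : 0 < q ^ (i + 1) - 1 := by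
  have := one_lt_pow₀ hq i.succ_ne_zero
  simpa using this

lemma codimWeight_pos (hq : 1 < q) (hθ : 0 < θ) (d : ℕ) : 0 < codimWeight q θ d := by
  have hq0 : 0 < q := by linarith
  have := Finset.prod_pos (s := Finset.range d)
    fun i _ => div_pos hq0 (pow_succ_sub_one_pos hq i)
  unfold codimWeight
  positivity

/-- Completing the square turns the Gaussian power into θ^(-d) q^(-d(d-1)/2), and the quotient of
infinite products is 1/(q⁻¹; q⁻¹)_d. The factors then match one by one. -/
lemma codimLaw_eq (hq : 1 < q) (hθ : 0 < θ) (d : ℕ) :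
    codimLaw q θ d = codimWeight q θ d / qPochInf (-θ⁻¹) q⁻¹ := by
  have hq0 : 0 < q := by linarith
  have hr : q⁻¹ < 1 := inv_lt_one_of_one_lt₀ hq
  have hr0 : 0 < q⁻¹ := by positivity
  have h1 : q ^ (-((d : ℝ) + 1)) = q⁻¹ * q⁻¹ ^ d := by
    rw [Real.rpow_neg hq0.le, ← pow_succ', inv_pow]
    norm_cast
  have h2 := prod_mul_qPochInf hq q⁻¹ d
  have h3 : qPochInf (q⁻¹ * q⁻¹ ^ d) q⁻¹ ≠ 0 := by
    refine qPochInf_ne_zero hq fun i => ?_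
    have : (q⁻¹ * q⁻¹ ^ d) * q⁻¹ ^ i < 1 := by
      rw [mul_assoc, ← pow_add, ← pow_succ']
      exact pow_lt_one₀ hr0.le hr (Nat.succ_ne_zero _)
    linarith
  have h4 : q ^ (-(1 / 2 : ℝ) * ((d : ℝ) - (1 / 2 - Real.logb q θ)) ^ 2
      + (1 / 2 : ℝ) * (1 / 2 - Real.logb q θ) ^ 2)
      = θ⁻¹ ^ d * ∏ i ∈ Finset.range d, q⁻¹ ^ i := by
    clear h1 h2 h3
    have hl : q ^ Real.logb q θ = θ := Real.rpow_logb hq0 hq.ne' hθ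
    induction d with
    | zero =>
      have : (-(1 / 2 : ℝ) * (((0 : ℕ) : ℝ) - (1 / 2 - Real.logb q θ)) ^ 2
        + (1 / 2 : ℝ) * (1 / 2 - Real.logb q θ) ^ 2) = 0 := by
        push_cast; ring
      simp only [this, Real.rpow_zero, Finset.range_zero, Finset.prod_empty, pow_zero, mul_one]
    | succ d ih =>
      rw [Finset.prod_range_succ, pow_succ θ⁻¹]
      have : (-(1 / 2 : ℝ) * (((d + 1 : ℕ) : ℝ) - (1 / 2 - Real.logb q θ)) ^ 2
        + (1 / 2 : ℝ) * (1 / 2 - Real.logb q θ) ^ 2) =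
        (-(1 / 2 : ℝ) * ((d : ℝ) - (1 / 2 - Real.logb q θ)) ^ 2
        + (1 / 2 : ℝ) * (1 / 2 - Real.logb q θ) ^ 2) + (-(Real.logb q θ) + -(d : ℝ)) := by
        push_cast; ring
      rw [this, Real.rpow_add hq0, ih, Real.rpow_add hq0, Real.rpow_neg hq0.le,
        Real.rpow_neg hq0.le, hl, Real.rpow_natCast, inv_pow]
      ring
  have h5 : codimWeight q θ d * ∏ i ∈ Finset.range d, (1 - q⁻¹ * q⁻¹ ^ i)
      = θ⁻¹ ^ d * ∏ i ∈ Finset.range d, q⁻¹ ^ i := by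
    rw [codimWeight, mul_assoc, ← Finset.prod_mul_distrib]
    congr 1
    refine Finset.prod_congr rfl fun i _ => ?_
    have := (pow_succ_sub_one_pos hq i).ne'
    rw [← pow_succ', inv_pow, inv_pow]
    field_simp
    ring
  have h6 : ∏ i ∈ Finset.range d, (1 - q⁻¹ * q⁻¹ ^ i) ≠ 0 := by
    refine Finset.prod_ne_zero_iff.2 fun i _ => ?_
    rw [← pow_succ']
    exact (sub_pos.2 (pow_lt_one₀ hr0.le hr (Nat.succ_ne_zero i))).ne'
  rw [codimLaw, h1, h4, ← h2, ← h5, mul_assoc (codimWeight q θ d), mul_comm (codimWeight q θ d),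
    mul_div_mul_left _ _ (mul_ne_zero h6 h3)]

lemma codimLaw_pos (hq : 1 < q) (hθ : 0 < θ) (d : ℕ) : 0 < codimLaw q θ d := by
  rw [codimLaw_eq hq hθ]
  have := one_le_qPochInf hq hθ
  exact div_pos (codimWeight_pos hq hθ d) (by linarith)

lemma factor_eq (hq : 1 < q) {n i : ℕ} (hi : i ≤ n) :
    (q ^ (n - i) - 1) * q⁻¹ ^ n * q ^ i = 1 - q ^ i * q⁻¹ ^ n := by
  have hq0 : q ≠ 0 := by linarith
  have : q ^ n = q ^ (n - i) * q ^ i := by rw [← pow_add]; congr 1; omega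
  rw [inv_pow, sub_mul, sub_mul, mul_right_comm, ← this]
  field_simp

lemma factor_mem_Icc (hq : 1 < q) (n i : ℕ) :
    (q ^ (n - i) - 1) * q⁻¹ ^ n * q ^ i ∈ Set.Icc (0 : ℝ) 1 := by
  have hq0 : 0 < q := by linarith
  have h1 : 0 ≤ q ^ (n - i) - 1 := sub_nonneg.2 (one_le_pow₀ hq.le)
  refine ⟨by positivity, ?_⟩
  rcases le_total i n with hi | hi
  · rw [factor_eq hq hi]
    have : 0 ≤ q ^ i * q⁻¹ ^ n := by positivity
    linarith
  · simp [Nat.sub_eq_zero_of_le hi]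

lemma tendsto_factor (hq : 1 < q) (i : ℕ) :
    Tendsto (fun n : ℕ => (q ^ (n - i) - 1) * q⁻¹ ^ n * q ^ i) atTop (𝓝 1) := by
  have h : Tendsto (fun n : ℕ => 1 - q ^ i * q⁻¹ ^ n) atTop (𝓝 (1 - q ^ i * 0)) :=
    ((tendsto_pow_atTop_nhds_zero_of_lt_one (by positivity)
      (inv_lt_one_of_one_lt₀ hq)).const_mul _).const_sub _
  simp only [mul_zero, sub_zero] at h
  refine h.congr' ?_
  filter_upwards [eventually_ge_atTop i] with n hn
  rw [factor_eq hq hn]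

lemma prod_factor_mem_Icc (hq : 1 < q) (d n : ℕ) :
    ∏ i ∈ Finset.range d, ((q ^ (n - i) - 1) * q⁻¹ ^ n * q ^ i) ∈ Set.Icc (0 : ℝ) 1 :=
  ⟨Finset.prod_nonneg fun i _ => (factor_mem_Icc hq n i).1,
    Finset.prod_le_one (fun i _ => (factor_mem_Icc hq n i).1) fun i _ => (factor_mem_Icc hq n i).2⟩

lemma codimProb_nonneg (hq : 1 < q) (hθ : 0 < θ) (d n : ℕ) : 0 ≤ codimProb q θ d n :=
  div_nonneg (mul_nonneg (codimWeight_pos hq hθ d).le (prod_factor_mem_Icc hq d n).1)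
    (zero_le_one.trans (one_le_normalizer hq hθ n))

/-- A bound independent of n, used as the dominating function that prevents loss of mass. -/
lemma codimProb_le (hq : 1 < q) (hθ : 0 < θ) (d n : ℕ) :
    codimProb q θ d n ≤ codimWeight q θ d := by
  have h := codimWeight_pos hq hθ d
  have h1 := one_le_normalizer hq hθ n
  rw [codimProb, div_le_iff₀ (by linarith)]
  have h2 := (prod_factor_mem_Icc hq d n).2
  nlinarith

lemma tendsto_codimProb (hq : 1 < q) (hθ : 0 < θ) (d : ℕ) :
    Tendsto (codimProb q θ d) atTop (𝓝 (codimLaw q θ d)) := by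
  rw [codimLaw_eq hq hθ]
  have h1 := one_le_qPochInf hq hθ
  have h2 : Tendsto (fun n : ℕ => ∏ i ∈ Finset.range d, ((q ^ (n - i) - 1) * q⁻¹ ^ n * q ^ i))
      atTop (𝓝 (∏ i ∈ Finset.range d, 1)) := tendsto_finsetProd _ fun i _ => tendsto_factor hq i
  rw [Finset.prod_const_one] at h2
  have := (h2.const_mul (codimWeight q θ d)).div (tendsto_normalizer hq θ) (by linarith)
  rwa [mul_one] at this

/-- The limit law of the codimension is a probability law, provided that the laws at finite times
are. -/
lemma hasSum_codimLaw (hq : 1 < q) (hθ : 0 < θ)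
    (h : ∀ n, HasSum (fun d => codimProb q θ d n) 1) : HasSum (codimLaw q θ) 1 := by
  have hZ := one_le_qPochInf hq hθ
  -- Partial sums of the limit inherit the bound 1, so μ is summable. The dominating weights are a
  -- constant multiple of μ, so they are summable too.
  have hs : Summable (codimLaw q θ) := by
    refine summable_of_sum_range_le (c := 1) (fun d => (codimLaw_pos hq hθ d).le) fun m => ?_
    refine le_of_tendsto' (tendsto_finsetSum _ fun d _ => tendsto_codimProb hq hθ d) fun n => ?_
    exact sum_le_hasSum _ (fun d _ => codimProb_nonneg hq hθ d n) (h n)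
  have hw : Summable (codimWeight q θ) := by
    refine (hs.mul_right (qPochInf (-θ⁻¹) q⁻¹)).congr fun d => ?_
    rw [codimLaw_eq hq hθ, div_mul_cancel₀ _ (by linarith)]
  have ht := tendsto_tsum_of_dominated_convergence hw (tendsto_codimProb hq hθ)
    (Eventually.of_forall fun n d => by
      rw [Real.norm_of_nonneg (codimProb_nonneg hq hθ d n)]; exact codimProb_le hq hθ d n)
  simp only [(h _).tsum_eq] at ht
  rw [tendsto_nhds_unique tendsto_const_nhds ht]
  exact hs.hasSum

/-- At a continuity point of the quantile function, the distribution function crosses the level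
`p` strictly. -/
lemma lt_sum_codimLaw_of_continuousWithinAt (hsum : HasSum (codimLaw q θ) 1) {p : ℝ}
    (hp : p ∈ Set.Ioo (0 : ℝ) 1)
    (hcont : ContinuousWithinAt (codimQuantile q θ) (Set.Ico (0 : ℝ) 1) p) :
    p < ∑ k ∈ Finset.range (codimQuantile q θ p + 1), codimLaw q θ k ∧
      ∑ k ∈ Finset.range (codimQuantile q θ p), codimLaw q θ k < p := by
  -- The quantile is integer-valued, so continuity at an interior point makes it locally constant.
  -- Comparing p with a nearby x on either side gives the two strict inequalities.
  have hev : ∀ᶠ x in 𝓝 p, codimQuantile q θ x = codimQuantile q θ p ∧ x ∈ Set.Ioo (0 : ℝ) 1 := by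
    have h1 := (hcont.continuousAt (Ico_mem_nhds hp.1 hp.2)).eventually
      (show ∀ᶠ y in 𝓝 (codimQuantile q θ p), y = codimQuantile q θ p by simp)
    exact h1.and (Ioo_mem_nhds hp.1 hp.2)
  obtain ⟨a, b, hab, hsub⟩ := (mem_nhds_iff_exists_Ioo_subset).1 hev
  constructor
  · obtain ⟨x, hx1, hx2⟩ := exists_between hab.2
    obtain ⟨hx3, hx4⟩ := hsub ⟨hab.1.trans hx1, hx2⟩
    have hne : {d : ℕ | x ≤ ∑ k ∈ Finset.range (d + 1), codimLaw q θ k}.Nonempty := by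
      have := ((tendsto_add_atTop_iff_nat 1).2 hsum.tendsto_sum_nat).eventually
        (eventually_ge_nhds hx4.2)
      exact this.exists
    have := Nat.sInf_mem hne
    rw [← hx3]
    exact hx1.trans_le this
  · obtain ⟨x, hx1, hx2⟩ := exists_between hab.1
    obtain ⟨hx3, hx4⟩ := hsub ⟨hx1, hx2.trans hab.2⟩
    rcases Nat.eq_zero_or_pos (codimQuantile q θ p) with h0 | h0
    · simpa [h0] using hp.1
    · rw [← hx3] at h0 ⊢
      have : codimQuantile q θ x - 1 < codimQuantile q θ x := by omega
      have := Nat.notMem_of_lt_sInf this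
      simp only [Set.mem_ofPred_eq, not_le] at this
      rw [Nat.sub_add_cancel h0] at this
      exact this.trans hx2

end Analysis

/-! ### Upper bounds on cardinalities. -/

section Count

variable {F : Type*} [Field F] [Fintype F]
  {e : ∀ n : ℕ, (Fin n → F) →ₗ[F] (Fin (n + 1) → F)}

lemma one_lt_card_cast (F : Type*) [Field F] [Fintype F] : 1 < (Fintype.card F : ℝ) := by
  exact_mod_cast Fintype.one_lt_card

/-- As q ≥ 2, every denominator q^(i+1) - 1 of the Gaussian binomial is at least 1 and can be
dropped. -/
lemma ncard_codimGr_le (he : ∀ n, Function.Injective (e n)) (d n : ℕ) :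
    ((codimGr F d n).ncard : ℝ) ≤ ((Fintype.card F : ℝ) ^ n) ^ d := by
  have hq : (2 : ℝ) ≤ Fintype.card F := by exact_mod_cast Fintype.one_lt_card
  have hq1 := one_lt_card_cast F
  have h1 : 1 ≤ ∏ i ∈ Finset.range d, ((Fintype.card F : ℝ) ^ (i + 1) - 1) := by
    refine Finset.one_le_prod fun i _ => ?_
    have := le_self_pow₀ hq1.le i.succ_ne_zero
    simp only [Nat.succ_eq_add_one] at this
    linarith
  calc ((codimGr F d n).ncard : ℝ)
      ≤ (codimGr F d n).ncard * ∏ i ∈ Finset.range d, ((Fintype.card F : ℝ) ^ (i + 1) - 1) :=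
        le_mul_of_one_le_right (Nat.cast_nonneg _) h1
    _ = ∏ i ∈ Finset.range d, ((Fintype.card F : ℝ) ^ (n - i) - 1) :=
        ncard_codimGr_mul_prod e he n d
    _ ≤ ∏ i ∈ Finset.range d, (Fintype.card F : ℝ) ^ n := by
        refine Finset.prod_le_prod (fun i _ => sub_nonneg.2 (one_le_pow₀ hq1.le)) fun i _ => ?_
        have := pow_le_pow_right₀ hq1.le (Nat.sub_le n i)
        linarith
    _ = _ := by simp

lemma ncard_topGr_le (he : ∀ n, Function.Injective (e n)) (m n : ℕ) :
    ((topGr F m n).ncard : ℝ) ≤ (m + 1) * ((Fintype.card F : ℝ) ^ n) ^ m := by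
  have hq1 := one_lt_card_cast F
  rw [topGr_eq_biUnion_codimGr]
  calc _ ≤ ((∑ d ∈ Finset.range (m + 1), (codimGr F d n).ncard : ℕ) : ℝ) := by
        exact_mod_cast Finset.set_ncard_biUnion_le _ _
    _ ≤ ∑ d ∈ Finset.range (m + 1), ((Fintype.card F : ℝ) ^ n) ^ m := by
        push_cast
        refine Finset.sum_le_sum fun d hd => (ncard_codimGr_le he d n).trans ?_
        rw [Finset.mem_range] at hd
        exact pow_le_pow_right₀ (one_le_pow₀ hq1.le) (by omega)
    _ = _ := by simp

end Count

lemma finrank_le_of_totalGr {F : Type*} [Field F] {n : ℕ} (v : TotalGr F n) : Module.finrank F v ≤ n := by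
  simpa using Submodule.finrank_le v

lemma minCard_le {F : Type*} [Field F] {Ω : Type*} [MeasurableSpace Ω] {P : Measure Ω}
    {V : ∀ n : ℕ, Ω → TotalGr F n} {ε : ℝ} {n : ℕ} {B : Set (TotalGr F n)} (hB : 1 - ε ≤ P.real (V n ⁻¹' B)) :
    minCard P V n ε ≤ B.ncard :=
  Nat.sInf_le ⟨B, rfl, hB⟩

lemma exists_ncard_eq_minCard {F : Type*} [Field F] {Ω : Type*} [MeasurableSpace Ω] {P : Measure Ω}
    [IsProbabilityMeasure P] {V : ∀ n : ℕ, Ω → TotalGr F n} {ε : ℝ} (hε : 0 ≤ ε) (n : ℕ) :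
    ∃ B : Set (TotalGr F n), B.ncard = minCard P V n ε ∧ 1 - ε ≤ P.real (V n ⁻¹' B) :=
  Nat.sInf_mem (s := {c : ℕ | ∃ B : Set (TotalGr F n), B.ncard = c ∧ 1 - ε ≤ P.real (V n ⁻¹' B)})
    ⟨_, Set.univ, rfl, by simpa using hε⟩

/-! ### Law of the codimension, typical index, minimal sets. -/

section Typical

variable {F : Type*} [Field F] [Fintype F]
  {e : ∀ n : ℕ, (Fin n → F) →ₗ[F] (Fin (n + 1) → F)}
  {Ω : Type*} [MeasurableSpace Ω] {P : Measure Ω} [IsProbabilityMeasure P]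
  {θ : ℝ} {X Y : ℕ → Ω → ℕ} {V : ∀ n : ℕ, Ω → TotalGr F n}

/-- The probability of a subspace of codimension `d` of `F ^ n`, up to the factor
`q ^ (-n d)` and the normalising factor. -/
noncomputable def pointWeight (q θ : ℝ) (d : ℕ) : ℝ :=
  θ⁻¹ ^ d * ∏ i ∈ Finset.range d, q ^ (i + 1)

lemma pointWeight_pos {q θ : ℝ} (hq : 0 < q) (hθ : 0 < θ) (d : ℕ) : 0 < pointWeight q θ d := by
  have := Finset.prod_pos (s := Finset.range d) fun i _ => pow_pos hq (i + 1)
  unfold pointWeight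
  positivity

lemma IsGrassmannianProcess.prob_singleton (hV : IsGrassmannianProcess P e X V)
    (hY : IsQBinomialProcess P (Fintype.card F) θ X Y) (hθ : 0 < θ)
    (he : ∀ n, Function.Injective (e n)) {n d : ℕ} {v : TotalGr F n} (hv : v ∈ codimGr F d n) :
    P.real (V n ⁻¹' {v}) = pointWeight (Fintype.card F) θ d *
      ((Fintype.card F : ℝ)⁻¹ ^ n) ^ d / normalizer (Fintype.card F) θ n := by
  have h := one_le_normalizer (one_lt_card_cast F) hθ n
  rw [eq_div_iff (by linarith), normalizer, hV.prob_mul_prod hY hθ he n d v hv, pointWeight]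
  ring

lemma IsGrassmannianProcess.prob_preimage (hV : IsGrassmannianProcess P e X V) (n : ℕ)
    (B : Finset (TotalGr F n)) : P.real (V n ⁻¹' B) = ∑ v ∈ B, P.real (V n ⁻¹' {v}) :=
  (sum_measureReal_preimage_singleton B fun v _ =>
    hV.measurable n (measurableSet_singleton v)).symm

lemma IsGrassmannianProcess.prob_codimGr (hV : IsGrassmannianProcess P e X V)
    (hY : IsQBinomialProcess P (Fintype.card F) θ X Y) (hθ : 0 < θ)
    (he : ∀ n, Function.Injective (e n)) (d n : ℕ) :
    P.real (V n ⁻¹' codimGr F d n) = codimProb (Fintype.card F) θ d n := by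
  have hfin := Set.toFinite (codimGr F d n)
  have hq1 := one_lt_card_cast F
  have h := hV.prob_preimage n hfin.toFinset
  rw [Finset.sum_congr rfl fun v hv => hV.prob_singleton hY hθ he (hfin.mem_toFinset.1 hv),
    Finset.sum_const, nsmul_eq_mul, ← Set.ncard_eq_toFinset_card, hfin.coe_toFinset] at h
  have hprod : ∏ i ∈ Finset.range d, ((Fintype.card F : ℝ) ^ (i + 1) - 1) ≠ 0 :=
    Finset.prod_ne_zero_iff.2 fun i _ => (pow_succ_sub_one_pos hq1 i).ne'
  rw [h, eq_div_of_mul_eq hprod (ncard_codimGr_mul_prod e he n d), codimProb, codimWeight,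
    pointWeight, ← mul_div_assoc]
  congr 1
  simp only [Finset.prod_mul_distrib, Finset.prod_div_distrib, Finset.prod_const,
    Finset.card_range, pow_succ']
  field_simp

lemma IsGrassmannianProcess.prob_topGr (hV : IsGrassmannianProcess P e X V)
    (hY : IsQBinomialProcess P (Fintype.card F) θ X Y) (hθ : 0 < θ)
    (he : ∀ n, Function.Injective (e n)) (m n : ℕ) :
    P.real (V n ⁻¹' topGr F m n) =
      ∑ d ∈ Finset.range (m + 1), codimProb (Fintype.card F) θ d n := by
  rw [topGr_eq_biUnion_codimGr, Set.preimage_iUnion₂, measureReal_biUnion_finset]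
  · exact Finset.sum_congr rfl fun d _ => hV.prob_codimGr hY hθ he d n
  · exact fun d _ d' _ h => (pairwise_disjoint_codimGr F n h).preimage _
  · exact fun d _ => hV.measurable n .of_discrete

lemma IsGrassmannianProcess.prob_compl_topGr (hV : IsGrassmannianProcess P e X V)
    (hY : IsQBinomialProcess P (Fintype.card F) θ X Y) (hθ : 0 < θ)
    (he : ∀ n, Function.Injective (e n)) (m n : ℕ) :
    P.real (V n ⁻¹' (topGr F m n)ᶜ) =
      1 - ∑ d ∈ Finset.range (m + 1), codimProb (Fintype.card F) θ d n := by
  rw [Set.preimage_compl, probReal_compl_eq_one_sub (hV.measurable n .of_discrete),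
    hV.prob_topGr hY hθ he]

/-- Codimensions above n do not occur. The normalisation, a q-binomial identity, comes for free from
total probability one. -/
lemma IsGrassmannianProcess.hasSum_codimProb (hV : IsGrassmannianProcess P e X V)
    (hY : IsQBinomialProcess P (Fintype.card F) θ X Y) (hθ : 0 < θ)
    (he : ∀ n, Function.Injective (e n)) (n : ℕ) :
    HasSum (fun d => codimProb (Fintype.card F) θ d n) 1 := by
  have h1 : topGr F n n = Set.univ := by
    refine Set.eq_univ_of_forall fun v => mem_topGr_iff.2 ⟨n - Module.finrank F v, by omega, ?_⟩
    have := finrank_le_of_totalGr v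
    omega
  have h2 := hV.prob_topGr hY hθ he n n
  rw [h1, Set.preimage_univ, probReal_univ] at h2
  rw [h2]
  refine hasSum_sum_of_ne_finset_zero fun d hd => ?_
  rw [Finset.mem_range] at hd
  have h3 : codimGr F d n = ∅ := by
    refine Set.eq_empty_of_forall_notMem fun v hv => ?_
    simp only [codimGr, Set.mem_ofPred_eq] at hv
    omega
  rw [← hV.prob_codimGr hY hθ he, h3, Set.preimage_empty, measureReal_empty]

/-- The typical index is eventually the quantile. -/
lemma IsGrassmannianProcess.eventually_typicalIndex_eq (hV : IsGrassmannianProcess P e X V)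
    (hY : IsQBinomialProcess P (Fintype.card F) θ X Y) (hθ : 0 < θ)
    (he : ∀ n, Function.Injective (e n)) {ε : ℝ} {D : ℕ}
    (hD : 1 - ε < ∑ k ∈ Finset.range (D + 1), codimLaw (Fintype.card F) θ k)
    (hD' : ∑ k ∈ Finset.range D, codimLaw (Fintype.card F) θ k < 1 - ε) :
    ∀ᶠ n in atTop, P.real (V n ⁻¹' (topGr F D n)ᶜ) ≤ ε ∧ typicalIndex P V ε n = D := by
  have hq1 := one_lt_card_cast F
  have hlim (m : ℕ) := tendsto_finsetSum (Finset.range m) fun d _ => tendsto_codimProb hq1 hθ d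
  filter_upwards [(hlim (D + 1)).eventually_const_lt hD, (hlim D).eventually_lt_const hD']
    with n h1 h2
  have hmem : P.real (V n ⁻¹' (topGr F D n)ᶜ) ≤ ε := by
    rw [hV.prob_compl_topGr hY hθ he]
    linarith
  refine ⟨hmem, le_antisymm (Nat.sInf_le hmem) (le_csInf ⟨D, hmem⟩ fun m hm => ?_)⟩
  by_contra! hlt
  rw [Set.mem_ofPred_eq, hV.prob_compl_topGr hY hθ he] at hm
  have := Finset.sum_le_sum_of_subset_of_nonneg (Finset.range_subset_range.2 hlt)
    fun d _ _ => codimProb_nonneg hq1 hθ d n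
  linarith

/-- Subspaces whose codimension lies between `D` and `M` have uniformly small probability. -/
lemma IsGrassmannianProcess.prob_singleton_le (hV : IsGrassmannianProcess P e X V)
    (hY : IsQBinomialProcess P (Fintype.card F) θ X Y) (hθ : 0 < θ)
    (he : ∀ n, Function.Injective (e n)) {n d D M : ℕ} (hD : D ≤ d) (hM : d < M)
    {v : TotalGr F n} (hv : v ∈ codimGr F d n) :
    P.real (V n ⁻¹' {v}) ≤ (∑ d ∈ Finset.range M, pointWeight (Fintype.card F) θ d) *
      ((Fintype.card F : ℝ)⁻¹ ^ n) ^ D := by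
  have hq1 := one_lt_card_cast F
  have hq0 : (0 : ℝ) < Fintype.card F := by linarith
  have hZ := one_le_normalizer hq1 hθ n
  have hw := pointWeight_pos hq0 hθ
  rw [hV.prob_singleton hY hθ he hv]
  refine (div_le_self (by have := hw d; positivity) hZ).trans ?_
  have h1 : (Fintype.card F : ℝ)⁻¹ ^ n ≤ 1 :=
    pow_le_one₀ (by positivity) (inv_lt_one_of_one_lt₀ hq1).le
  have h2 : pointWeight (Fintype.card F) θ d ≤
      ∑ d ∈ Finset.range M, pointWeight (Fintype.card F) θ d :=
    Finset.single_le_sum (f := pointWeight (Fintype.card F) θ) (fun d _ => (hw d).le)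
      (Finset.mem_range.2 hM)
  exact mul_le_mul h2 (pow_le_pow_of_le_one (by positivity) h1 hD) (by positivity)
    ((hw d).le.trans h2)

/-- A set of probability at least `1 - ε` has, up to a constant, at least `q ^ (n D)` elements. -/
lemma IsGrassmannianProcess.exists_le_minCard (hV : IsGrassmannianProcess P e X V)
    (hY : IsQBinomialProcess P (Fintype.card F) θ X Y) (hθ : 0 < θ)
    (he : ∀ n, Function.Injective (e n)) {ε : ℝ} (hε : 0 ≤ ε) {D : ℕ}
    (hD : ∑ k ∈ Finset.range D, codimLaw (Fintype.card F) θ k < 1 - ε) :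
    ∃ c > 0, ∀ᶠ n in atTop, c * ((Fintype.card F : ℝ) ^ n) ^ D ≤ minCard P V n ε := by
  have hq1 := one_lt_card_cast F
  have hq0 : (0 : ℝ) < Fintype.card F := by linarith
  have hlim (m : ℕ) := tendsto_finsetSum (Finset.range m) fun d _ => tendsto_codimProb hq1 hθ d
  have hsum := hasSum_codimLaw hq1 hθ (hV.hasSum_codimProb hY hθ he)
  set S := ∑ k ∈ Finset.range D, codimLaw (Fintype.card F) θ k with hS
  -- Low codimensions cost S + η and high ones η, which leaves the middle more than 4η - 2η ≥ η.
  set η := (1 - ε - S) / 4 with hη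
  have hη0 : 0 < η := by rw [hη]; linarith
  obtain ⟨M, hM⟩ := (hsum.tendsto_sum_nat.eventually_const_lt
    (show 1 - η < 1 by linarith)).exists
  -- `topGr F M n` includes codimension M itself, hence the range M + 1.
  have hM' : 1 - η < ∑ k ∈ Finset.range (M + 1), codimLaw (Fintype.card F) θ k := by
    rw [Finset.sum_range_succ]
    have := codimLaw_pos hq1 hθ M
    linarith
  set K := ∑ d ∈ Finset.range (M + 1), pointWeight (Fintype.card F) θ d with hK
  have hK0 : 0 < K := Finset.sum_pos (fun d _ => pointWeight_pos hq0 hθ d) ⟨0, by simp⟩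
  refine ⟨η / K, by positivity, ?_⟩
  filter_upwards [(hlim (M + 1)).eventually_const_lt hM',
    (hlim D).eventually_lt_const (show S < S + η by linarith)] with n h1 h2
  obtain ⟨B, hB, hBP⟩ := exists_ncard_eq_minCard (P := P) (V := V) hε n
  rw [← hB]
  set low : Set (TotalGr F n) := ⋃ d ∈ Finset.range D, codimGr F d n with hlow
  set mid : Set (TotalGr F n) := B ∩ (topGr F M n \ low) with hmid
  have hcover : V n ⁻¹' B ⊆ V n ⁻¹' mid ∪ (V n ⁻¹' low ∪ V n ⁻¹' (topGr F M n)ᶜ) := by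
    intro ω hω
    by_cases ha : V n ω ∈ topGr F M n
    · by_cases hb : V n ω ∈ low
      · exact Or.inr (Or.inl hb)
      · exact Or.inl ⟨hω, ha, hb⟩
    · exact Or.inr (Or.inr ha)
  have hlowP : P.real (V n ⁻¹' low) = ∑ d ∈ Finset.range D, codimProb (Fintype.card F) θ d n := by
    rw [hlow, Set.preimage_iUnion₂, measureReal_biUnion_finset]
    · exact Finset.sum_congr rfl fun d _ => hV.prob_codimGr hY hθ he d n
    · exact fun d _ d' _ h => (pairwise_disjoint_codimGr F n h).preimage _
    · exact fun d _ => hV.measurable n .of_discrete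
  have h3 : P.real (V n ⁻¹' B) ≤ P.real (V n ⁻¹' mid) +
      (P.real (V n ⁻¹' low) + P.real (V n ⁻¹' (topGr F M n)ᶜ)) :=
    (measureReal_mono hcover).trans ((measureReal_union_le _ _).trans
      (by gcongr; exact measureReal_union_le _ _))
  rw [hlowP, hV.prob_compl_topGr hY hθ he] at h3
  have h4 : η ≤ P.real (V n ⁻¹' mid) := by linarith
  have hfin := Set.toFinite mid
  have h5 := hV.prob_preimage n hfin.toFinset
  have h6 : ∑ v ∈ hfin.toFinset, P.real (V n ⁻¹' {v}) ≤
      ∑ v ∈ hfin.toFinset, K * ((Fintype.card F : ℝ)⁻¹ ^ n) ^ D := by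
    refine Finset.sum_le_sum fun v hv => ?_
    obtain ⟨-, hv1, hv2⟩ := hfin.mem_toFinset.1 hv
    obtain ⟨d, hd, hvd⟩ := mem_topGr_iff.1 hv1
    refine hV.prob_singleton_le hY hθ he (d := d) ?_ (by omega) hvd
    by_contra! hlt
    exact hv2 (Set.mem_biUnion (Finset.mem_coe.2 (Finset.mem_range.2 hlt)) hvd)
  rw [Finset.sum_const, nsmul_eq_mul, ← Set.ncard_eq_toFinset_card] at h6
  rw [hfin.coe_toFinset] at h5
  have h7 : (mid.ncard : ℝ) ≤ B.ncard := by
    exact_mod_cast Set.ncard_le_ncard Set.inter_subset_left (Set.toFinite B)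
  have h8 : η ≤ B.ncard * (K * ((Fintype.card F : ℝ)⁻¹ ^ n) ^ D) := by
    refine h4.trans (h5.le.trans (h6.trans ?_))
    gcongr
  have h9 : ((Fintype.card F : ℝ)⁻¹ ^ n) ^ D * ((Fintype.card F : ℝ) ^ n) ^ D = 1 := by
    rw [← mul_pow, ← mul_pow, inv_mul_cancel₀ hq0.ne', one_pow, one_pow]
  rw [div_mul_eq_mul_div, div_le_iff₀ hK0]
  calc η * ((Fintype.card F : ℝ) ^ n) ^ D
      ≤ B.ncard * (K * ((Fintype.card F : ℝ)⁻¹ ^ n) ^ D) * ((Fintype.card F : ℝ) ^ n) ^ D := by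
        gcongr
    _ = B.ncard * K * (((Fintype.card F : ℝ)⁻¹ ^ n) ^ D * ((Fintype.card F : ℝ) ^ n) ^ D) := by
        ring
    _ = _ := by rw [h9, mul_one]

end Typical

/-! ### Exponential rates and the quadratic entropy. -/

section Limits

variable {q θ : ℝ}

lemma tendsto_logb_const_mul_pow_div (hq : 1 < q) {c : ℝ} (hc : 0 < c) (D : ℕ) :
    Tendsto (fun n : ℕ => 1 / (n : ℝ) * Real.logb q (c * (q ^ n) ^ D)) atTop (𝓝 D) := by
  have hq0 : 0 < q := by linarith
  have h : Tendsto (fun n : ℕ => Real.logb q c / (n : ℝ) + D) atTop (𝓝 (0 + D)) :=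
    (tendsto_const_div_atTop_nhds_zero_nat _).add_const _
  rw [zero_add] at h
  refine h.congr' ?_
  filter_upwards [eventually_gt_atTop 0] with n hn
  have hn' : (n : ℝ) ≠ 0 := by positivity
  rw [Real.logb_mul hc.ne' (by positivity), Real.logb_pow, Real.logb_pow, Real.logb_self_eq_one hq]
  field_simp

lemma tendsto_logb_div_of_bounds (hq : 1 < q) {c C : ℝ} (hc : 0 < c) {D : ℕ} {a : ℕ → ℝ}
    (hlo : ∀ᶠ n in atTop, c * (q ^ n) ^ D ≤ a n) (hhi : ∀ᶠ n in atTop, a n ≤ C * (q ^ n) ^ D) :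
    Tendsto (fun n : ℕ => 1 / (n : ℝ) * Real.logb q (a n)) atTop (𝓝 D) := by
  have hq0 : 0 < q := by linarith
  have hC : 0 < C := by
    obtain ⟨n, h1, h2⟩ := (hlo.and hhi).exists
    have : 0 < c * (q ^ n) ^ D := by positivity
    exact pos_of_mul_pos_left (this.trans_le (h1.trans h2)) (by positivity)
  refine tendsto_of_tendsto_of_tendsto_of_le_of_le' (tendsto_logb_const_mul_pow_div hq hc D)
    (tendsto_logb_const_mul_pow_div hq hC D) ?_ ?_
  · filter_upwards [hlo] with n h
    exact mul_le_mul_of_nonneg_left (Real.logb_le_logb_of_le hq (by positivity) h) (by positivity)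
  · filter_upwards [hlo, hhi] with n h h'
    exact mul_le_mul_of_nonneg_left (Real.logb_le_logb_of_le hq
      ((show 0 < c * (q ^ n) ^ D by positivity).trans_le h) h') (by positivity)

lemma half_mul_binQuadEntropy {n : ℕ} (hn : n ≠ 0) (d : ℝ) :
    (n : ℝ) / 2 * binQuadEntropy (d / n) = d - d ^ 2 / n := by
  have hn' : (n : ℝ) ≠ 0 := by positivity
  simp only [binQuadEntropy, quadEntropy, Fin.sum_univ_two, Matrix.cons_val_zero,
    Matrix.cons_val_one]
  field_simp
  ring

lemma tendsto_half_mul_binQuadEntropy (d : ℝ) :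
    Tendsto (fun n : ℕ => (n : ℝ) / 2 * binQuadEntropy (d / n)) atTop (𝓝 d) := by
  have h : Tendsto (fun n : ℕ => d - d ^ 2 / (n : ℝ)) atTop (𝓝 (d - 0)) :=
    (tendsto_const_div_atTop_nhds_zero_nat _).const_sub _
  rw [sub_zero] at h
  refine h.congr' ?_
  filter_upwards [eventually_gt_atTop 0] with n hn
  rw [half_mul_binQuadEntropy hn.ne']

lemma binQuadEntropy_one_sub (x : ℝ) : binQuadEntropy (1 - x) = binQuadEntropy x := by
  simp only [binQuadEntropy, quadEntropy, Fin.sum_univ_two, Matrix.cons_val_zero,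
    Matrix.cons_val_one]
  ring

/-- The normaliser converges to a positive limit, so its logarithm is o(n); only the factor q^(-nd)
contributes to the rate. -/
lemma tendsto_logb_inv_prob_div (hq : 1 < q) (hθ : 0 < θ) (d : ℕ) :
    Tendsto (fun n : ℕ => Real.logb q
      ((pointWeight q θ d * (q⁻¹ ^ n) ^ d / normalizer q θ n)⁻¹) / n) atTop (𝓝 d) := by
  have hq0 : 0 < q := by linarith
  have hw := pointWeight_pos hq0 hθ d
  have hZ (n : ℕ) : 0 < normalizer q θ n := zero_lt_one.trans_le (one_le_normalizer hq hθ n)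
  have hZ' : 0 < qPochInf (-θ⁻¹) q⁻¹ := zero_lt_one.trans_le (one_le_qPochInf hq hθ)
  have h1 : Tendsto (fun n : ℕ => Real.logb q (normalizer q θ n)) atTop
      (𝓝 (Real.logb q (qPochInf (-θ⁻¹) q⁻¹))) :=
    (tendsto_normalizer hq θ).logb hZ'.ne'
  have h2 := ((h1.sub_const (Real.logb q (pointWeight q θ d))).div_atTop
    (tendsto_natCast_atTop_atTop (R := ℝ))).add_const (d : ℝ)
  rw [zero_add] at h2
  refine h2.congr' ?_
  filter_upwards [eventually_gt_atTop 0] with n hn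
  have hn' : (n : ℝ) ≠ 0 := by positivity
  have hZn := (hZ n).ne'
  rw [Real.logb_inv, Real.logb_div (by positivity) hZn, Real.logb_mul hw.ne' (by positivity),
    Real.logb_pow, Real.logb_pow, Real.logb_inv, Real.logb_self_eq_one hq]
  field_simp
  ring

end Limits

theorem mainTheorem1
    {F : Type*} [Field F] [Fintype F] (q : ℕ) (hq : Fintype.card F = q)
    (e : ∀ n : ℕ, (Fin n → F) →ₗ[F] (Fin (n + 1) → F))
    (he : ∀ n, Function.Injective (e n))
    {Ω : Type*} [MeasurableSpace Ω] (P : Measure Ω) [IsProbabilityMeasure P]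
    (θ : ℝ) (hθ : 0 < θ)
    (X Y : ℕ → Ω → ℕ) (hY : IsQBinomialProcess P q θ X Y)
    (V : ∀ n : ℕ, Ω → TotalGr F n) (hV : IsGrassmannianProcess P e X V)
    (δ : ℝ) (hδ : δ ∈ Set.Ioo (0 : ℝ) 1)
    (ε : ℝ) (hε : ε ∈ Set.Ioo (0 : ℝ) 1)
    (hcont : ContinuousWithinAt (codimQuantile q θ) (Set.Ico (0 : ℝ) 1) (1 - ε)) :
    (∃ n₀ : ℕ, ∀ n ≥ n₀,
      typicalSet P V ε n = topGr F (codimQuantile q θ (1 - ε)) n ∧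
      ∀ v ∈ typicalSet P V ε n, ∀ k : ℕ, Module.finrank F v = k →
        0 < P.real (V n ⁻¹' {v}) ∧
        |Real.logb q ((P.real (V n ⁻¹' {v}))⁻¹) / n
          - (n : ℝ) / 2 * binQuadEntropy ((k : ℝ) / n)| ≤ δ) ∧
    Tendsto (fun n : ℕ => 1 / (n : ℝ) * Real.logb q ((typicalSet P V ε n).ncard : ℝ)) atTop
      (𝓝 (codimQuantile q θ (1 - ε) : ℝ)) ∧
    Tendsto (fun n : ℕ => 1 / (n : ℝ) * Real.logb q (minCard P V n ε : ℝ)) atTop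
      (𝓝 (codimQuantile q θ (1 - ε) : ℝ)) ∧
    Tendsto (fun n : ℕ => (n : ℝ) / 2 * binQuadEntropy ((codimQuantile q θ (1 - ε) : ℝ) / n)) atTop
      (𝓝 (codimQuantile q θ (1 - ε) : ℝ)) := by
  subst hq
  have hq1 := one_lt_card_cast F
  have hq0 : (0 : ℝ) < Fintype.card F := by linarith
  have hsum := hasSum_codimLaw hq1 hθ (hV.hasSum_codimProb hY hθ he)
  obtain ⟨hD, hD'⟩ := lt_sum_codimLaw_of_continuousWithinAt hsum
    ⟨by linarith [hε.2], by linarith [hε.1]⟩ hcont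
  set D := codimQuantile (Fintype.card F) θ (1 - ε)
  have hind := hV.eventually_typicalIndex_eq hY hθ he hD hD'
  obtain ⟨c, hc, hlo⟩ := hV.exists_le_minCard hY hθ he hε.1.le hD'
  have hmin : ∀ᶠ n in atTop, (minCard P V n ε : ℝ) ≤ (typicalSet P V ε n).ncard := by
    filter_upwards [hind] with n hn
    rw [typicalSet, hn.2]
    have h1 := hn.1
    rw [Set.preimage_compl, probReal_compl_eq_one_sub (hV.measurable n .of_discrete)] at h1
    exact_mod_cast minCard_le (by linarith)
  have hhi : ∀ᶠ n in atTop, ((typicalSet P V ε n).ncard : ℝ) ≤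
      (D + 1) * ((Fintype.card F : ℝ) ^ n) ^ D := by
    filter_upwards [hind] with n hn
    rw [typicalSet, hn.2]
    exact ncard_topGr_le he D n
  refine ⟨?_, ?_, ?_, tendsto_half_mul_binQuadEntropy _⟩
  -- For each d the difference tends to d - d; the finitely many d ≤ D then share a single
  -- threshold.
  · have hd (d : ℕ) := ((tendsto_logb_inv_prob_div hq1 hθ d).sub
      (tendsto_half_mul_binQuadEntropy d)).eventually
        (Metric.closedBall_mem_nhds _ hδ.1)
    have hall := (Finset.eventually_all (Finset.range (D + 1))).2 fun d _ => hd d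
    obtain ⟨n₀, hn₀⟩ := eventually_atTop.1 (hind.and (hall.and (eventually_gt_atTop 0)))
    refine ⟨n₀, fun n hn => ?_⟩
    obtain ⟨hidx, hlog, hn0⟩ := hn₀ n hn
    have hA : typicalSet P V ε n = topGr F D n := by rw [typicalSet, hidx.2]
    refine ⟨hA, fun v hv k hk => ?_⟩
    rw [hA, mem_topGr_iff] at hv
    obtain ⟨d, hdD, hvd⟩ := hv
    have hn' : (n : ℝ) ≠ 0 := by positivity
    have hZ := one_le_normalizer hq1 hθ n
    have hw := pointWeight_pos hq0 hθ d
    have hkn : (k : ℝ) / n = 1 - d / n := by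
      rw [eq_sub_iff_add_eq, ← add_div, div_eq_one_iff_eq hn', ← hk]
      exact_mod_cast hvd
    rw [hV.prob_singleton hY hθ he hvd, hkn, binQuadEntropy_one_sub]
    refine ⟨by positivity, ?_⟩
    have := hlog d (Finset.mem_range.2 (by omega))
    simpa [Real.dist_eq] using this
  · refine tendsto_logb_div_of_bounds hq1 hc ?_ hhi
    filter_upwards [hlo, hmin] with n h1 h2 using h1.trans h2
  · refine tendsto_logb_div_of_bounds (C := D + 1) hq1 hc hlo ?_
    filter_upwards [hhi, hmin] with n h1 h2 using h2.trans h1
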